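/- Let $\ell^2$ be the complex Hilbert space with standard basis $(e_n)_{n\ge 0}$. For a bounded sequence $\alpha=(\alpha_n)_{n\ge 0}$ of positive numbers let $W_\alpha$ be the weighted shift on $\ell^2$, the bounded operator with $W_\alpha e_n=\alpha_n e_{n+1}$. An operator is subnormal if it is unitarily equivalent to the restriction of a normal operator on a complex Hilbert space to a closed invariant subspace. The shift $W_\alpha$ is moment infinitely divisible (MID) if for every real $t>0$ the shift with weights $(\alpha_n^t)$ is subnormal. For a real sequence $\psi$ put $(\nabla\psi)(n)=\psi(n)-\psi(n+1)$. The sequence $\psi$ is completely alternating if $(\nabla^k\psi)(n)\le 0$ for all $k\ge 1$, $n\ge 0$; a sequence $x$ of positive numbers is log completely alternating if $(\ln x_n)$ is completely alternating. Write $C(x_n)$ for the sequence with $n$-th term $\frac{x_0+\cdots+x_n}{n+1}$, and $GC(x_n)$ for the sequence with $n$-th term $\sqrt[n+1]{x_0x_1\cdots x_n}$. **Corollary 3.10 (Cesàro-transformed shifts).** Let $W_\alpha$ be a contractive weighted shift (that is, $\|W_\alpha\|\le 1$) with positive weights $\alpha_n$. 1. If the squared weights $(\alpha_n^2)$ are completely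 alternating, then the shift with weights $\sqrt{C(\alpha_n^2)}$ and the shift with weights $C(\alpha_n)$ both have completely alternating weights, are contractive, and are MID and subnormal. 2. The sequence $(\alpha_n^2)$ is log completely alternating if and only if $(\alpha_n)$ is. If this is the case, then the shift with weights $GC(\alpha_n)$ has log completely alternating weights and is MID and subnormal. -/

import Mathlib

/-- The complex Hilbert space `ℓ²` of square-summable sequences indexed by `ℕ`. -/
abbrev EllTwo : Type := lp (fun _ : ℕ => ℂ) 2

/-- The coordinates of the weighted shift of `x`: `(x₀, x₁, …) ↦ (0, α₀ x₀, α₁ x₁, …)`. -/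
def shiftCoord (α : ℕ → ℝ) (x : ℕ → ℂ) : ℕ → ℂ
  | 0 => 0
  | n + 1 => (α n : ℂ) * x n

lemma norm_sq_eq_tsum (x : EllTwo) : ‖x‖ ^ 2 = ∑' i, ‖x i‖ ^ 2 := by
  have h := lp.norm_rpow_eq_tsum (p := 2) (by norm_num) x
  simpa using h

lemma summable_norm_sq (x : EllTwo) : Summable fun i => ‖x i‖ ^ 2 := by
  have h := (lp.memℓp x).summable (p := 2) (by norm_num)
  simpa using h

lemma norm_shiftCoord_succ_sq_le {α : ℕ → ℝ} {M : ℝ} (hM : ∀ n, |α n| ≤ M) (x : ℕ → ℂ)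
    (n : ℕ) : ‖shiftCoord α x (n + 1)‖ ^ 2 ≤ M ^ 2 * ‖x n‖ ^ 2 := by
  have h0 : ‖shiftCoord α x (n + 1)‖ = |α n| * ‖x n‖ := by simp [shiftCoord]
  rw [h0, mul_pow]
  gcongr
  exact hM n

lemma summable_shiftCoord {α : ℕ → ℝ} {M : ℝ} (hM : ∀ n, |α n| ≤ M) (x : EllTwo) :
    Summable fun n => ‖shiftCoord α x n‖ ^ 2 := by
  rw [← summable_nat_add_iff 1]
  exact Summable.of_nonneg_of_le (fun n => by positivity)
    (norm_shiftCoord_succ_sq_le hM x) ((summable_norm_sq x).mul_left _)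

lemma memℓp_shiftCoord {α : ℕ → ℝ} (hα : BddAbove (Set.range fun n => |α n|)) (x : EllTwo) :
    Memℓp (shiftCoord α x) 2 := by
  obtain ⟨M, hM⟩ := hα
  refine memℓp_gen ?_
  simpa using summable_shiftCoord (fun n => hM ⟨n, rfl⟩) x

/-- The unilateral weighted shift `W_α` on `ℓ²` with bounded weight sequence `α`, as a bounded
operator; `weightedShift_single` below shows that `W_α e_j = α_j e_{j+1}`. -/
noncomputable def weightedShift (α : ℕ → ℝ) (hα : BddAbove (Set.range fun n => |α n|)) :
    EllTwo →L[ℂ] EllTwo :=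
  LinearMap.mkContinuousOfExistsBound
    { toFun := fun x => ⟨shiftCoord α x, memℓp_shiftCoord hα x⟩
      map_add' := by
        intro x y
        ext n
        change shiftCoord α (x + y : EllTwo) n = shiftCoord α x n + shiftCoord α y n
        cases n <;> simp [shiftCoord, mul_add]
      map_smul' := by
        intro c x
        ext n
        cases n <;> simp [shiftCoord, mul_left_comm] }
    (by
      obtain ⟨M, hM⟩ := hα
      have hM' : ∀ n, |α n| ≤ M := fun n => hM ⟨n, rfl⟩
      have hM0 : 0 ≤ M := (abs_nonneg _).trans (hM' 0)
      refine ⟨M, fun x => ?_⟩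
      refine le_of_sq_le_sq ?_ (by positivity)
      rw [norm_sq_eq_tsum, mul_pow, norm_sq_eq_tsum x, ← tsum_mul_left]
      have hs := summable_shiftCoord hM' x
      change (∑' i, ‖shiftCoord α x i‖ ^ 2) ≤ _
      rw [hs.tsum_eq_zero_add]
      have h0 : ‖shiftCoord α x 0‖ ^ 2 = 0 := by simp [shiftCoord]
      rw [h0, zero_add]
      exact ((summable_nat_add_iff 1).2 hs).tsum_le_tsum
        (norm_shiftCoord_succ_sq_le hM' x) ((summable_norm_sq x).mul_left _))

lemma weightedShift_apply (α : ℕ → ℝ) (hα : BddAbove (Set.range fun n => |α n|)) (x : EllTwo)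
    (n : ℕ) : weightedShift α hα x n = shiftCoord α x n := rfl

lemma weightedShift_single (α : ℕ → ℝ) (hα : BddAbove (Set.range fun n => |α n|)) (j : ℕ) :
    weightedShift α hα (lp.single 2 j (1 : ℂ)) = (α j : ℂ) • lp.single 2 (j + 1) (1 : ℂ) := by
  ext n
  rw [weightedShift_apply, lp.coeFn_smul, Pi.smul_apply, smul_eq_mul]
  cases n with
  | zero => simp [shiftCoord]
  | succ n =>
    by_cases h : n = j
    · subst h; simp [shiftCoord]
    · simp [shiftCoord, h]

/-- A bounded operator `T` on a complex Hilbert space is subnormal if it is unitarily equivalent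
to the restriction of a normal operator `N` to a closed invariant subspace. Here the subspace is
the range of the isometry `V`, and `V` implements the unitary equivalence. -/
def IsSubnormalOperator {H : Type} [NormedAddCommGroup H] [InnerProductSpace ℂ H]
    [CompleteSpace H] (T : H →L[ℂ] H) : Prop :=
  ∃ (K : Type) (_ : NormedAddCommGroup K) (_ : InnerProductSpace ℂ K) (_ : CompleteSpace K)
    (N : K →L[ℂ] K) (V : H →ₗᵢ[ℂ] K), IsStarNormal N ∧ ∀ x, N (V x) = V (T x)

/-- The weighted shift with weights `α` is (bounded and) subnormal. -/
def IsSubnormalShift (α : ℕ → ℝ) : Prop :=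
  ∃ hα : BddAbove (Set.range fun n => |α n|), IsSubnormalOperator (weightedShift α hα)

/-- The weighted shift with weights `α` is (bounded and) a contraction. -/
def IsContractiveShift (α : ℕ → ℝ) : Prop :=
  ∃ hα : BddAbove (Set.range fun n => |α n|), ‖weightedShift α hα‖ ≤ 1

/-- The weighted shift with positive weights `α` is moment infinitely divisible: for every `t > 0`
the shift with weights `α_n ^ t` is subnormal. -/
def IsMIDShift (α : ℕ → ℝ) : Prop :=
  (∀ n, 0 < α n) ∧ ∀ t : ℝ, 0 < t → IsSubnormalShift fun n => α n ^ t

/-- The difference operator `(∇ φ)(n) = φ(n) - φ(n + 1)`. -/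
def nabla (φ : ℕ → ℝ) : ℕ → ℝ := fun n => φ n - φ (n + 1)

/-- `ψ` is completely alternating: `(∇^k ψ)(n) ≤ 0` for all `k ≥ 1` and `n ≥ 0`. -/
def CompletelyAlternating (ψ : ℕ → ℝ) : Prop :=
  ∀ k : ℕ, 1 ≤ k → ∀ n : ℕ, (nabla^[k] ψ) n ≤ 0

/-- `x` is log completely alternating: it has positive terms and its logarithm is completely
alternating. -/
def LogCompletelyAlternating (x : ℕ → ℝ) : Prop :=
  (∀ n, 0 < x n) ∧ CompletelyAlternating fun n => Real.log (x n)

/-- The Cesàro transform: `C(x)_n = (x_0 + … + x_n) / (n + 1)`. -/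
noncomputable def cesaro (x : ℕ → ℝ) : ℕ → ℝ :=
  fun n => (∑ i ∈ Finset.range (n + 1), x i) / ((n : ℝ) + 1)

/-- The geometric Cesàro transform: `GC(x)_n` is the `(n + 1)`-st root of `x_0 x_1 ⋯ x_n`. -/
noncomputable def geomCesaro (x : ℕ → ℝ) : ℕ → ℝ :=
  fun n => (∏ i ∈ Finset.range (n + 1), x i) ^ (1 / ((n : ℝ) + 1))

/-! Everything rests on one fact (`LogCompletelyAlternating.isMIDShift`): positive weights `α ≤ 1`
with `log α` completely alternating give an MID shift. The moments of the shift with weights `α ^ t`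
are `exp (-2t φ)` with `φ n = -∑ i < n, log (α i)`. Since `∇φ = log α ≤ 0`, `φ` is completely
alternating, so by Schoenberg's theorem (`CompletelyAlternating.exp_neg`) the moments are completely
monotone. Hausdorff's theorem represents them as the moments of `‖z‖ ^ 2` under a rotation-symmetric
positive functional on the disc. Multiplication by `z` on its GNS space is normal and extends the
shift, which is Berger's criterion.

It remains to produce such weights. If `ψ` is completely alternating in `(0, 1]`, then `1 - ψ` is
completely monotone, a property stable under sums, products and pointwise limits; power series and
iteration then show that `log ψ` and `√ψ` are completely alternating. The Cesàro transform preserves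
complete alternation by a recurrence for its differences, and `log` turns `geomCesaro` into
`cesaro`. -/

open Filter Topology

/-! ### Iterated differences and completely monotone sequences. -/

/-- The difference operator `nabla` as a linear map. -/
def nablaLinear : (ℕ → ℝ) →ₗ[ℝ] (ℕ → ℝ) where
  toFun := nabla
  map_add' f g := by ext n; simp only [nabla, Pi.add_apply]; ring
  map_smul' c f := by
    ext n; simp only [nabla, Pi.smul_apply, smul_eq_mul, RingHom.id_apply]; ring

lemma nabla_iterate_eq (k : ℕ) (f : ℕ → ℝ) : nabla^[k] f = (nablaLinear ^ k) f := by
  rw [Module.End.pow_apply]; rfl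

lemma nabla_iterate_succ_apply (k : ℕ) (f : ℕ → ℝ) (n : ℕ) :
    nabla^[k + 1] f n = nabla^[k] f n - nabla^[k] f (n + 1) := by
  rw [Function.iterate_succ_apply']; rfl

lemma nabla_iterate_shift (k : ℕ) (f : ℕ → ℝ) (n : ℕ) :
    nabla^[k] (fun i => f (i + 1)) n = nabla^[k] f (n + 1) := by
  induction k generalizing n with
  | zero => rfl
  | succ k ih => rw [nabla_iterate_succ_apply, nabla_iterate_succ_apply, ih, ih]

lemma nabla_iterate_const_sub (c : ℝ) (f : ℕ → ℝ) {k : ℕ} (hk : 1 ≤ k) (n : ℕ) :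
    nabla^[k] (fun i => c - f i) n = -nabla^[k] f n := by
  obtain ⟨k, rfl⟩ := Nat.exists_eq_add_of_le' hk
  induction k generalizing n with
  | zero => simp [nabla]
  | succ k ih =>
    rw [nabla_iterate_succ_apply, ih _ (by omega), ih _ (by omega), nabla_iterate_succ_apply (k + 1)]
    ring

lemma nabla_iterate_const_mul (c : ℝ) (f : ℕ → ℝ) (k n : ℕ) :
    nabla^[k] (fun i => c * f i) n = c * nabla^[k] f n := by
  have : (fun i => c * f i) = c • f := rfl
  rw [this, nabla_iterate_eq, map_smul, nabla_iterate_eq]; rfl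

lemma nabla_iterate_add (f g : ℕ → ℝ) (k n : ℕ) :
    nabla^[k] (fun i => f i + g i) n = nabla^[k] f n + nabla^[k] g n := by
  have : (fun i => f i + g i) = f + g := rfl
  rw [this, nabla_iterate_eq, map_add, nabla_iterate_eq, nabla_iterate_eq]; rfl

lemma tendsto_nabla_iterate {ι : Type*} {l : Filter ι} {F : ι → ℕ → ℝ} {f : ℕ → ℝ}
    (h : ∀ n, Tendsto (fun i => F i n) l (𝓝 (f n))) (k n : ℕ) :
    Tendsto (fun i => nabla^[k] (F i) n) l (𝓝 (nabla^[k] f n)) := by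
  induction k generalizing n with
  | zero => exact h n
  | succ k ih =>
    simp only [nabla_iterate_succ_apply]
    exact (ih n).sub (ih (n + 1))

/-- The differences of all orders of `f` that only involve `f 0, …, f L` are nonnegative. -/
def CompletelyMonotoneUpTo (L : ℕ) (f : ℕ → ℝ) : Prop :=
  ∀ k n : ℕ, n + k ≤ L → 0 ≤ nabla^[k] f n

/-- `f` is completely monotone: `(∇^k f)(n) ≥ 0` for all `k, n ≥ 0`. -/
def CompletelyMonotone (f : ℕ → ℝ) : Prop := ∀ k n : ℕ, 0 ≤ nabla^[k] f n

lemma completelyMonotone_iff {f : ℕ → ℝ} :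
    CompletelyMonotone f ↔ ∀ L, CompletelyMonotoneUpTo L f :=
  ⟨fun h _ k n _ => h k n, fun h k n => h (n + k) k n le_rfl⟩

namespace CompletelyMonotoneUpTo

variable {L : ℕ} {f g : ℕ → ℝ}

lemma mono {L' : ℕ} (h : CompletelyMonotoneUpTo L f) (hL : L' ≤ L) :
    CompletelyMonotoneUpTo L' f := fun k n hkn => h k n (hkn.trans hL)

lemma nabla (h : CompletelyMonotoneUpTo (L + 1) f) : CompletelyMonotoneUpTo L (nabla f) := by
  intro k n hkn
  rw [← Function.iterate_succ_apply]
  exact h _ _ (by omega)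

lemma shift (h : CompletelyMonotoneUpTo (L + 1) f) :
    CompletelyMonotoneUpTo L (fun n => f (n + 1)) := by
  intro k n hkn
  rw [nabla_iterate_shift]
  exact h _ _ (by omega)

lemma add (hf : CompletelyMonotoneUpTo L f) (hg : CompletelyMonotoneUpTo L g) :
    CompletelyMonotoneUpTo L (fun n => f n + g n) := by
  intro k n hkn
  rw [nabla_iterate_add]
  exact add_nonneg (hf k n hkn) (hg k n hkn)

lemma const_mul {c : ℝ} (hc : 0 ≤ c) (hf : CompletelyMonotoneUpTo L f) :
    CompletelyMonotoneUpTo L (fun n => c * f n) := by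
  intro k n hkn
  rw [nabla_iterate_const_mul]
  exact mul_nonneg hc (hf k n hkn)

/-- Leibniz rule `∇(fg) = ∇f · g + (shift of f) · ∇g`. Differencing or shifting a factor costs one
level, so the induction on the order must let `L`, `f` and `g` vary. -/
lemma mul (hf : CompletelyMonotoneUpTo L f) (hg : CompletelyMonotoneUpTo L g) :
    CompletelyMonotoneUpTo L (fun n => f n * g n) := by
  intro k
  induction k generalizing L f g with
  | zero => exact fun n hn => mul_nonneg (hf 0 n hn) (hg 0 n hn)
  | succ k ih =>
    intro n hn
    obtain ⟨L, rfl⟩ : ∃ L', L = L' + 1 := ⟨L - 1, by omega⟩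
    have leibniz : _root_.nabla (fun n => f n * g n) =
        fun n => _root_.nabla f n * g n + f (n + 1) * _root_.nabla g n := by
      ext n; simp only [_root_.nabla]; ring
    rw [Function.iterate_succ_apply, leibniz, nabla_iterate_add]
    exact add_nonneg (ih hf.nabla (hg.mono (by omega)) n (by omega))
      (ih hf.shift hg.nabla n (by omega))

lemma const {c : ℝ} (hc : 0 ≤ c) : CompletelyMonotoneUpTo L (fun _ => c) := by
  intro k n _
  induction k generalizing n with
  | zero => exact hc
  | succ k _ =>
    have := nabla_iterate_const_sub c (fun _ => (0 : ℝ)) (k := k + 1) (by omega) n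
    have h0 := nabla_iterate_const_mul 0 (fun _ => (0 : ℝ)) (k + 1) n
    simp only [sub_zero, mul_zero, zero_mul] at this h0
    rw [this, h0, neg_zero]

lemma pow (hf : CompletelyMonotoneUpTo L f) (j : ℕ) :
    CompletelyMonotoneUpTo L (fun n => f n ^ j) := by
  induction j with
  | zero => simpa using const zero_le_one
  | succ j ih => simpa only [pow_succ] using ih.mul hf

lemma sum {ι : Type*} (s : Finset ι) {F : ι → ℕ → ℝ}
    (h : ∀ i ∈ s, CompletelyMonotoneUpTo L (F i)) :
    CompletelyMonotoneUpTo L (fun n => ∑ i ∈ s, F i n) := by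
  classical
  induction s using Finset.induction_on with
  | empty => simpa using const le_rfl
  | insert a s ha ih =>
    simp only [Finset.sum_insert ha]
    exact (h a (by simp)).add (ih fun i hi => h i (by simp [hi]))

lemma of_tendsto {ι : Type*} {l : Filter ι} [l.NeBot] {F : ι → ℕ → ℝ}
    (h : ∀ n, Tendsto (fun i => F i n) l (𝓝 (f n)))
    (hF : ∀ᶠ i in l, CompletelyMonotoneUpTo L (F i)) : CompletelyMonotoneUpTo L f :=
  fun k n hkn => ge_of_tendsto (tendsto_nabla_iterate h k n) (hF.mono fun _ hi => hi k n hkn)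

end CompletelyMonotoneUpTo

lemma CompletelyMonotone.completelyAlternating {f : ℕ → ℝ} (hf : CompletelyMonotone f) (c : ℝ) :
    CompletelyAlternating fun n => c - f n := by
  intro k hk n
  rw [nabla_iterate_const_sub c f hk]
  exact neg_nonpos.2 (hf k n)

/-! ### Functional calculus for completely alternating sequences. -/

namespace CompletelyAlternating

variable {ψ : ℕ → ℝ}

lemma completelyMonotoneUpTo_const_sub (h : CompletelyAlternating ψ) {c : ℝ} {L : ℕ}
    (hc : ∀ n ≤ L, ψ n ≤ c) : CompletelyMonotoneUpTo L fun n => c - ψ n := by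
  intro k n hkn
  rcases Nat.eq_zero_or_pos k with rfl | hk
  · exact sub_nonneg.2 (hc n (by omega))
  · rw [nabla_iterate_const_sub c ψ hk]
    exact neg_nonneg.2 (h k hk n)

lemma completelyMonotone_const_sub (h : CompletelyAlternating ψ) {c : ℝ}
    (hc : ∀ n, ψ n ≤ c) : CompletelyMonotone fun n => c - ψ n :=
  completelyMonotone_iff.2 fun _ => h.completelyMonotoneUpTo_const_sub fun n _ => hc n

lemma const_mul (h : CompletelyAlternating ψ) {c : ℝ} (hc : 0 ≤ c) :
    CompletelyAlternating fun n => c * ψ n := by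
  intro k hk n
  rw [nabla_iterate_const_mul]
  exact mul_nonpos_of_nonneg_of_nonpos hc (h k hk n)

/-- Schoenberg's theorem for sequences, by `exp (-ψ) = lim (1 - ψ / N) ^ N`. -/
lemma exp_neg (h : CompletelyAlternating ψ) : CompletelyMonotone fun n => Real.exp (-ψ n) := by
  refine completelyMonotone_iff.2 fun L => ?_
  refine .of_tendsto (fun n => Real.tendsto_one_add_div_pow_exp (-ψ n)) ?_
  -- `ψ` may be unbounded above, so `1 - ψ / N` is only known to be nonnegative on `0, …, L` for
  -- large `N`. This is why complete monotonicity is truncated at `L`.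
  obtain ⟨M, hM⟩ := ((Finset.range (L + 1)).image ψ).bddAbove
  have hM : ∀ n ≤ L, ψ n ≤ M := fun n hn =>
    hM (Finset.mem_coe.2 (Finset.mem_image_of_mem ψ (Finset.mem_range.2 (by omega))))
  filter_upwards [eventually_gt_atTop 0, tendsto_natCast_atTop_atTop.eventually_ge_atTop M]
    with N hN hMN
  have hN' : (0 : ℝ) < N := by exact_mod_cast hN
  refine CompletelyMonotoneUpTo.pow ?_ N
  have e : (fun n => 1 + -ψ n / (N : ℝ)) = fun n => (N : ℝ)⁻¹ * (N - ψ n) := by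
    ext n; field_simp; ring
  rw [e]
  exact .const_mul (by positivity)
    (h.completelyMonotoneUpTo_const_sub fun n hn => (hM n hn).trans hMN)

/-- The logarithm of a completely alternating sequence in `(0, 1]` is completely alternating, by
`-log (1 - u) = ∑ u ^ j / j`. -/
lemma log (h : CompletelyAlternating ψ) (h0 : ∀ n, 0 < ψ n) (h1 : ∀ n, ψ n ≤ 1) :
    CompletelyAlternating fun n => Real.log (ψ n) := by
  have hu := completelyMonotone_iff.1 (h.completelyMonotone_const_sub h1)
  have key : CompletelyMonotone fun n => -Real.log (ψ n) := by
    refine completelyMonotone_iff.2 fun L => ?_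
    have hs : ∀ n, HasSum (fun j : ℕ => (1 - ψ n) ^ (j + 1) / ((j : ℝ) + 1))
        (-Real.log (ψ n)) := fun n => by
      have := Real.hasSum_pow_div_log_of_abs_lt_one (x := 1 - ψ n)
        (by rw [abs_lt]; constructor <;> linarith [h0 n, h1 n])
      simpa using this
    refine .of_tendsto (fun n => (hs n).tendsto_sum_nat) (.of_forall fun N => ?_)
    refine .sum _ fun j _ => ?_
    simp only [div_eq_inv_mul]
    exact .const_mul (by positivity) ((hu L).pow _)
  simpa using key.completelyAlternating 0

/-- The square root of a completely alternating sequence in `(0, 1]` is completely alternating: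
`1 - √(1 - u)` is the limit of the iterates of `p ↦ (u + p ^ 2) / 2` started at `0`. -/
lemma sqrt (h : CompletelyAlternating ψ) (h0 : ∀ n, 0 < ψ n) (h1 : ∀ n, ψ n ≤ 1) :
    CompletelyAlternating fun n => √(ψ n) := by
  have hu := completelyMonotone_iff.1 (h.completelyMonotone_const_sub h1)
  let p : ℕ → ℕ → ℝ := fun j n => (fun x : ℝ => 2⁻¹ * ((1 - ψ n) + x ^ 2))^[j] 0
  have psucc : ∀ j n, p (j + 1) n = 2⁻¹ * ((1 - ψ n) + p j n ^ 2) := fun j n =>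
    Function.iterate_succ_apply' _ _ _
  have hp : ∀ L j, CompletelyMonotoneUpTo L (p j) := by
    intro L j
    induction j with
    | zero => exact .const le_rfl
    | succ j ih =>
      have e : p (j + 1) = fun n => 2⁻¹ * ((1 - ψ n) + p j n ^ 2) := funext (psucc j)
      rw [e]
      exact ((hu L).add (ih.pow 2)).const_mul (by norm_num)
  have key : CompletelyMonotone fun n => 1 - √(ψ n) := by
    refine completelyMonotone_iff.2 fun L => ?_
    refine .of_tendsto (l := atTop) (F := p) (fun n => ?_) (.of_forall (hp L))
    have hsq : √(ψ n) ^ 2 = ψ n := Real.sq_sqrt (h0 n).le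
    have hs0 : 0 < √(ψ n) := Real.sqrt_pos.2 (h0 n)
    have hs1 : √(ψ n) ≤ 1 := Real.sqrt_le_one.2 (h1 n)
    -- With `u = 1 - ψ n`, the number `s = 1 - √(ψ n)` is a fixed point of `p ↦ (u + p ^ 2) / 2`.
    -- One iteration therefore multiplies the error `s - p` by `(s + p) / 2 ≤ s < 1`.
    have bound : ∀ j, 0 ≤ (1 - √(ψ n)) - p j n ∧
        (1 - √(ψ n)) - p j n ≤ (1 - √(ψ n)) ^ j := by
      intro j
      induction j with
      | zero => simp [p, h1 n]
      | succ j ih =>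
        have hpj : 0 ≤ p j n := hp n j 0 n (by simp)
        have e : (1 - √(ψ n)) - p (j + 1) n =
            ((1 - √(ψ n)) - p j n) * (((1 - √(ψ n)) + p j n) / 2) := by
          rw [psucc]; linear_combination (-(1 / 2 : ℝ)) * hsq
        rw [e, pow_succ]
        constructor
        · exact mul_nonneg ih.1 (by linarith)
        · exact mul_le_mul ih.2 (by linarith) (by linarith) (by apply pow_nonneg; linarith)
    have hlim : Tendsto (fun j => (1 - √(ψ n)) - p j n) atTop (𝓝 0) :=
      squeeze_zero (fun j => (bound j).1) (fun j => (bound j).2)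
        (tendsto_pow_atTop_nhds_zero_of_lt_one (by linarith) (by linarith))
    simpa using hlim.const_sub (1 - √(ψ n))
  simpa using key.completelyAlternating 1

/-- The negated partial sums of a nonpositive completely alternating sequence are completely
alternating. -/
lemma neg_sum_range (h : CompletelyAlternating ψ) (h0 : ∀ n, ψ n ≤ 0) :
    CompletelyAlternating fun n => -∑ i ∈ Finset.range n, ψ i := by
  have hn : nabla (fun n => -∑ i ∈ Finset.range n, ψ i) = ψ := by
    ext n; simp [nabla, Finset.sum_range_succ]
  intro k hk n
  obtain ⟨k, rfl⟩ := Nat.exists_eq_add_of_le' hk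
  rw [Function.iterate_succ_apply, hn]
  -- One difference has been spent on undoing the sum; when none is left, the sign of `ψ` itself is
  -- needed.
  rcases Nat.eq_zero_or_pos k with rfl | hk
  · exact h0 n
  · exact h k hk n

end CompletelyAlternating

/-! ### The Cesàro transform preserves complete alternation. -/

lemma nabla_iterate_succ_linear_mul (y : ℕ → ℝ) (k n : ℕ) :
    nabla^[k + 1] (fun i => ((i : ℝ) + 1) * y i) n =
      ((n : ℝ) + 1) * nabla^[k + 1] y n - ((k : ℝ) + 1) * nabla^[k] y (n + 1) := by
  induction k generalizing n with
  | zero => simp [nabla]; ring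
  | succ k ih =>
    rw [nabla_iterate_succ_apply, ih, ih, nabla_iterate_succ_apply (k + 1) y,
      nabla_iterate_succ_apply k y (n + 1)]
    push_cast
    ring

/-- Obtained by differencing `(i + 1) C(x)_i`, whose first difference is `-x (i + 1)`. For fixed `k`
this is a recurrence in `n` with positive coefficients, so signs pass from `x` to `cesaro x`. -/
lemma nabla_iterate_cesaro_succ (x : ℕ → ℝ) (k n : ℕ) :
    ((n : ℝ) + k + 2) * nabla^[k] (cesaro x) (n + 1) =
      ((n : ℝ) + 1) * nabla^[k] (cesaro x) n + nabla^[k] x (n + 1) := by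
  have hS : nabla (fun i => ((i : ℝ) + 1) * cesaro x i) = fun i => -1 * x (i + 1) := by
    ext i
    have : (i : ℝ) + 1 + 1 ≠ 0 := by positivity
    simp only [nabla, cesaro]
    push_cast
    rw [Finset.sum_range_succ _ (i + 1)]
    field_simp
    ring
  have h := nabla_iterate_succ_linear_mul (cesaro x) k n
  rw [Function.iterate_succ_apply, hS, nabla_iterate_const_mul, nabla_iterate_shift,
    nabla_iterate_succ_apply] at h
  linear_combination h

lemma nabla_iterate_cesaro_zero (x : ℕ → ℝ) (k : ℕ) :
    ((k : ℝ) + 1) * nabla^[k] (cesaro x) 0 = nabla^[k] x 0 := by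
  induction k with
  | zero => simp [cesaro]
  | succ k ih =>
    have h := nabla_iterate_cesaro_succ x k 0
    rw [nabla_iterate_succ_apply, nabla_iterate_succ_apply]
    push_cast at h ⊢
    linear_combination ih - h

lemma CompletelyAlternating.cesaro {ψ : ℕ → ℝ} (h : CompletelyAlternating ψ) :
    CompletelyAlternating (cesaro ψ) := by
  intro k hk n
  induction n with
  | zero =>
    have e := nabla_iterate_cesaro_zero ψ k
    exact nonpos_of_mul_nonpos_right (e.trans_le (h k hk 0)) (by positivity)
  | succ n ih =>
    have e := nabla_iterate_cesaro_succ ψ k n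
    refine nonpos_of_mul_nonpos_right (e.trans_le ?_) (by positivity)
    exact add_nonpos (mul_nonpos_of_nonneg_of_nonpos (by positivity) ih) (h k hk _)

/-! ### Hausdorff's moment theorem: discrete approximations. -/

open scoped ComplexOrder

/-- Bernstein weights of a sequence `m`: the mass at `j / N` of the `N`-th discrete approximation
to a measure on `[0, 1]` with moments `m`. -/
noncomputable def bernsteinWeight (m : ℕ → ℝ) (N j : ℕ) : ℝ :=
  (N.choose j : ℝ) * nabla^[N - j] m j

lemma CompletelyMonotone.bernsteinWeight_nonneg {m : ℕ → ℝ} (hm : CompletelyMonotone m)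
    (N j : ℕ) : 0 ≤ bernsteinWeight m N j :=
  mul_nonneg (by positivity) (hm _ _)

/-- With `S` the shift, `S + ∇ = 1`; this is the binomial expansion of `(S + ∇) ^ n`. -/
lemma sum_choose_mul_nabla_iterate (m : ℕ → ℝ) (n k : ℕ) :
    ∑ j ∈ Finset.range (n + 1), (n.choose j : ℝ) * nabla^[n - j] m (k + j) = m k := by
  let S : Module.End ℝ (ℕ → ℝ) := LinearMap.funLeft ℝ ℝ (fun i : ℕ => i + 1)
  have hS : ∀ (j : ℕ) (f : ℕ → ℝ), (S ^ j) f = fun i => f (i + j) := by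
    intro j
    induction j with
    | zero => intro f; rfl
    | succ j ih =>
      intro f
      rw [pow_succ, Module.End.mul_apply, ih]
      ext i
      change f (i + j + 1) = _
      rw [add_assoc]
  have hadd : S + nablaLinear = 1 := by
    ext f i
    change f (i + 1) + (f i - f (i + 1)) = f i
    ring
  have hcomm : Commute S nablaLinear := by
    have : nablaLinear = 1 - S := by rw [← hadd]; abel
    rw [this]
    exact (Commute.one_right S).sub_right (Commute.refl S)
  have h := hcomm.add_pow n
  rw [hadd, one_pow] at h
  have h2 := congrFun (congrArg (fun T : Module.End ℝ (ℕ → ℝ) => T m) h) k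
  simp only [Module.End.one_apply, LinearMap.sum_apply, Finset.sum_apply] at h2
  rw [h2]
  refine Finset.sum_congr rfl fun j _ => ?_
  rw [← (Nat.cast_commute (n.choose j) _).eq, Module.End.mul_apply, Module.End.mul_apply, hS,
    nabla_iterate_eq, Module.End.natCast_apply, Pi.smul_apply, nsmul_eq_mul]

/-- Factorial moments of the Bernstein weights are exact: terms with `j < k` vanish, and the others
reduce to `sum_choose_mul_nabla_iterate` by absorbing the factorials into the binomial coefficients.
-/
lemma sum_bernsteinWeight_mul_descFactorial (m : ℕ → ℝ) (n k : ℕ) :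
    ∑ j ∈ Finset.range (k + n + 1), bernsteinWeight m (k + n) j * (j.descFactorial k : ℝ) =
      ((k + n).descFactorial k : ℝ) * m k := by
  rw [add_assoc, Finset.sum_range_add, Finset.sum_eq_zero, zero_add,
    ← sum_choose_mul_nabla_iterate m n k, Finset.mul_sum]
  · refine Finset.sum_congr rfl fun j _ => ?_
    have h : ((k + n).choose (k + j) : ℝ) * ((k + j).descFactorial k : ℝ) =
        ((k + n).descFactorial k : ℝ) * (n.choose j : ℝ) := by
      have := Nat.choose_mul (n := k + n) (k := k + j) (s := k) (by omega)
      rw [Nat.add_sub_cancel_left, Nat.add_sub_cancel_left] at this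
      rw [Nat.descFactorial_eq_factorial_mul_choose, Nat.descFactorial_eq_factorial_mul_choose]
      have : ((k + n).choose (k + j) : ℝ) * ((k + j).choose k : ℝ) =
        ((k + n).choose k : ℝ) * (n.choose j : ℝ) := by exact_mod_cast this
      push_cast
      linear_combination (k.factorial : ℝ) * this
    rw [bernsteinWeight, Nat.add_sub_add_left]
    linear_combination nabla^[n - j] m (k + j) * h
  · intro j hj
    rw [Nat.descFactorial_of_lt (Finset.mem_range.1 hj)]
    simp

lemma sum_bernsteinWeight (m : ℕ → ℝ) (N : ℕ) :
    ∑ j ∈ Finset.range (N + 1), bernsteinWeight m N j = m 0 := by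
  have h := sum_bernsteinWeight_mul_descFactorial m N 0
  simpa using h

/-- Divided by `N ^ (k + 1)`, this says that replacing factorial moments by ordinary ones costs at
most `k ^ 2 / N`. -/
lemma mul_pow_le_mul_descFactorial_add {j N : ℕ} (hj : j ≤ N) (k : ℕ) :
    (N : ℝ) * (j : ℝ) ^ k ≤ N * (j.descFactorial k : ℝ) + (k : ℝ) ^ 2 * (N : ℝ) ^ k := by
  induction k with
  | zero => simp
  | succ k ih =>
    have hjN : (j : ℝ) ≤ N := by exact_mod_cast hj
    have hd : (j.descFactorial k : ℝ) ≤ (N : ℝ) ^ k := by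
      have h1 : (j.descFactorial k : ℝ) ≤ (j : ℝ) ^ k := by
        exact_mod_cast Nat.descFactorial_le_pow j k
      exact h1.trans (by gcongr)
    have hsub : (j : ℝ) - k ≤ ((j - k : ℕ) : ℝ) := by
      rw [sub_le_iff_le_add]
      exact_mod_cast (by omega : j ≤ j - k + k)
    rw [Nat.descFactorial_succ]
    push_cast
    have h1 : ((j : ℝ) - k) * (j.descFactorial k : ℝ) ≤
        ((j - k : ℕ) : ℝ) * (j.descFactorial k : ℝ) := by gcongr
    have h2 := mul_le_mul_of_nonneg_left ih (Nat.cast_nonneg (α := ℝ) j)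
    have h3 := mul_le_mul_of_nonneg_left h1 (Nat.cast_nonneg (α := ℝ) N)
    have h4 : (k : ℝ) * N * (j.descFactorial k : ℝ) ≤ k * N * (N : ℝ) ^ k := by gcongr
    have h5 : (j : ℝ) * ((k : ℝ) ^ 2 * (N : ℝ) ^ k) ≤ N * ((k : ℝ) ^ 2 * (N : ℝ) ^ k) := by gcongr
    have h6 : 0 ≤ ((k : ℝ) + 1) * (N : ℝ) ^ (k + 1) := by positivity
    have e1 : (N : ℝ) * (j : ℝ) ^ (k + 1) = j * (N * (j : ℝ) ^ k) := by ring
    have e2 : ((k : ℝ) + 1) ^ 2 * (N : ℝ) ^ (k + 1) = k * N * (N : ℝ) ^ k +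
      N * ((k : ℝ) ^ 2 * (N : ℝ) ^ k) + ((k : ℝ) + 1) * (N : ℝ) ^ (k + 1) := by ring
    rw [e1, e2]
    linarith

/-- The moments of the discrete measures with weights `bernsteinWeight m N` converge to `m`. -/
lemma CompletelyMonotone.tendsto_sum_bernsteinWeight {m : ℕ → ℝ} (hm : CompletelyMonotone m)
    (k : ℕ) :
    Tendsto (fun N : ℕ => ∑ j ∈ Finset.range (N + 1), bernsteinWeight m N j * ((j : ℝ) / N) ^ k)
      atTop (𝓝 (m k)) := by
  have hlow : Tendsto (fun N : ℕ => (N.descFactorial k : ℝ) / (N : ℝ) ^ k * m k) atTop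
      (𝓝 (m k)) := by
    have h := (isEquivalent_descFactorial k)
    rw [Asymptotics.isEquivalent_iff_tendsto_one] at h
    · simpa using h.mul_const (m k)
    · filter_upwards [eventually_gt_atTop 0] with N hN
      have : (0 : ℝ) < N := by exact_mod_cast hN
      positivity
  have hupp : Tendsto (fun N : ℕ => (N.descFactorial k : ℝ) / (N : ℝ) ^ k * m k +
      (N : ℝ)⁻¹ * ((k : ℝ) ^ 2 * m 0)) atTop (𝓝 (m k)) := by
    simpa using hlow.add
      ((tendsto_inv_atTop_nhds_zero_nat (𝕜 := ℝ)).mul_const ((k : ℝ) ^ 2 * m 0))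
  have hsum : ∀ N : ℕ, k ≤ N → (N.descFactorial k : ℝ) / (N : ℝ) ^ k * m k =
      ∑ j ∈ Finset.range (N + 1),
        bernsteinWeight m N j * ((j.descFactorial k : ℝ) / (N : ℝ) ^ k) := by
    intro N hN
    obtain ⟨n, rfl⟩ := Nat.exists_eq_add_of_le hN
    rw [div_mul_eq_mul_div, ← sum_bernsteinWeight_mul_descFactorial, Finset.sum_div]
    exact Finset.sum_congr rfl fun j _ => mul_div_assoc _ _ _
  refine tendsto_of_tendsto_of_tendsto_of_le_of_le' hlow hupp ?_ ?_
  · filter_upwards [eventually_ge_atTop k] with N hN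
    rw [hsum N hN]
    refine Finset.sum_le_sum fun j _ => mul_le_mul_of_nonneg_left ?_ (hm.bernsteinWeight_nonneg N j)
    rw [div_pow]
    gcongr
    exact_mod_cast Nat.descFactorial_le_pow j k
  · filter_upwards [eventually_ge_atTop k, eventually_gt_atTop 0] with N hN hN0
    have hN' : (0 : ℝ) < N := by exact_mod_cast hN0
    rw [hsum N hN, ← sum_bernsteinWeight m N, Finset.mul_sum, Finset.mul_sum,
      ← Finset.sum_add_distrib]
    refine Finset.sum_le_sum fun j hj => ?_
    have h := mul_pow_le_mul_descFactorial_add (Finset.mem_range_succ_iff.1 hj) k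
    have h2 : ((j : ℝ) / N) ^ k ≤ (j.descFactorial k : ℝ) / (N : ℝ) ^ k + (N : ℝ)⁻¹ * (k : ℝ) ^ 2 := by
      rw [div_pow, div_le_iff₀ (by positivity)]
      refine le_of_mul_le_mul_left (h.trans_eq ?_) hN'
      field_simp
    calc _ ≤ _ := mul_le_mul_of_nonneg_left h2 (hm.bernsteinWeight_nonneg N j)
      _ = _ := by ring

/-! ### The rotation-symmetric functional on the disc. -/

/-- The closed unit disc. -/
abbrev ClosedDisc : Type := Metric.closedBall (0 : ℂ) 1

/-- The coordinate function on the closed unit disc. -/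
def discCoord : C(ClosedDisc, ℂ) := ⟨Subtype.val, continuous_subtype_val⟩

/-- The primitive `N`-th root of unity `exp (2πi / N)`. -/
noncomputable def rootOfUnity (N : ℕ) : ℂ := Complex.exp (2 * Real.pi * Complex.I / N)

lemma norm_rootOfUnity (N : ℕ) : ‖rootOfUnity N‖ = 1 := by
  have : (2 * Real.pi * Complex.I / N : ℂ) = ((2 * Real.pi / N : ℝ) : ℂ) * Complex.I := by
    push_cast; ring
  rw [rootOfUnity, this, Complex.norm_exp_ofReal_mul_I]

/-- The point of the disc with squared modulus `j / N` and argument `2πi / N`. -/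
noncomputable def discNode {N : ℕ} (j : Fin (N + 1)) (i : ℕ) : ClosedDisc :=
  ⟨(√((j : ℕ) / N : ℝ) : ℂ) * rootOfUnity N ^ i, by
    have hj : ((j : ℕ) : ℝ) ≤ N := by exact_mod_cast Nat.lt_succ_iff.1 j.2
    rw [mem_closedBall_zero_iff, norm_mul, norm_pow, norm_rootOfUnity, one_pow, mul_one,
      Complex.norm_real, Real.norm_of_nonneg (Real.sqrt_nonneg _)]
    exact Real.sqrt_le_one.2 (div_le_one_of_le₀ hj (by positivity))⟩

/-- Integration against the rotation-symmetric discrete measure on the disc whose image under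
`z ↦ ‖z‖ ^ 2` has weights `bernsteinWeight m N`. -/
noncomputable def discSum (m : ℕ → ℝ) (N : ℕ) (f : C(ClosedDisc, ℂ)) : ℂ :=
  ∑ j : Fin (N + 1), (bernsteinWeight m N j : ℂ) *
    ((N : ℂ)⁻¹ * ∑ i ∈ Finset.range N, f (discNode j i))

lemma discSum_add (m : ℕ → ℝ) (N : ℕ) (f g : C(ClosedDisc, ℂ)) :
    discSum m N (f + g) = discSum m N f + discSum m N g := by
  simp only [discSum, ContinuousMap.add_apply, Finset.sum_add_distrib, mul_add]

lemma discSum_smul (m : ℕ → ℝ) (N : ℕ) (c : ℂ) (f : C(ClosedDisc, ℂ)) :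
    discSum m N (c • f) = c * discSum m N f := by
  simp only [discSum, ContinuousMap.smul_apply, smul_eq_mul, Finset.mul_sum]
  exact Finset.sum_congr rfl fun j _ => Finset.sum_congr rfl fun i _ => by ring

lemma CompletelyMonotone.discSum_nonneg {m : ℕ → ℝ} (hm : CompletelyMonotone m) (N : ℕ)
    {f : C(ClosedDisc, ℂ)} (hf : 0 ≤ f) : 0 ≤ discSum m N f := by
  refine Finset.sum_nonneg fun j _ => mul_nonneg ?_ (mul_nonneg ?_ ?_)
  · exact Complex.zero_le_real.2 (hm.bernsteinWeight_nonneg _ _)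
  · have : ((N : ℂ))⁻¹ = ((N : ℝ)⁻¹ : ℝ) := by push_cast; rfl
    rw [this]
    exact Complex.zero_le_real.2 (by positivity)
  · exact Finset.sum_nonneg fun i _ => hf _

lemma CompletelyMonotone.norm_discSum_le {m : ℕ → ℝ} (hm : CompletelyMonotone m) (N : ℕ)
    (f : C(ClosedDisc, ℂ)) : ‖discSum m N f‖ ≤ m 0 * ‖f‖ := by
  have hs := Fin.sum_univ_eq_sum_range (bernsteinWeight m N) (N + 1)
  rw [sum_bernsteinWeight] at hs
  rw [← hs, Finset.sum_mul]
  refine norm_sum_le_of_le _ fun j _ => ?_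
  rw [norm_mul, Complex.norm_real, Real.norm_of_nonneg (hm.bernsteinWeight_nonneg _ _)]
  refine mul_le_mul_of_nonneg_left ?_ (hm.bernsteinWeight_nonneg _ _)
  have h : ‖∑ i ∈ Finset.range N, f (discNode j i)‖ ≤ N * ‖f‖ := by
    simpa using norm_sum_le_of_le (Finset.range N)
      (f := fun i => f (discNode j i)) (n := fun _ => ‖f‖) fun i _ => f.norm_coe_le_norm _
  rw [norm_mul, norm_inv, Complex.norm_natCast]
  rcases Nat.eq_zero_or_pos N with rfl | hN
  · simp
  · have : (0 : ℝ) < N := by exact_mod_cast hN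
    rwa [inv_mul_le_iff₀ this]

/-- Averaging over the `N`-th roots of unity kills the monomial unless `a ≡ b` mod `N`, which for
`a, b < N` means `a = b`. -/
lemma discSum_star_pow_mul_pow (m : ℕ → ℝ) {N a b : ℕ} (ha : a < N) (hb : b < N) :
    discSum m N (star discCoord ^ a * discCoord ^ b) = if a = b then
      ((∑ j ∈ Finset.range (N + 1), bernsteinWeight m N j * ((j : ℝ) / N) ^ a : ℝ) : ℂ) else 0 := by
  have hN : N ≠ 0 := by omega
  have hN' : (N : ℂ) ≠ 0 := by exact_mod_cast hN
  set ζ := rootOfUnity N with hζ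
  have hprim : IsPrimitiveRoot ζ N := Complex.isPrimitiveRoot_exp N hN
  have hconj : (starRingEnd ℂ) ζ * ζ = 1 := by
    rw [mul_comm, Complex.mul_conj, Complex.normSq_eq_norm_sq, norm_rootOfUnity]; simp
  have hval : ∀ (j : Fin (N + 1)) (i : ℕ),
      (star discCoord ^ a * discCoord ^ b : C(ClosedDisc, ℂ)) (discNode j i) =
        (√((j : ℕ) / N : ℝ) : ℂ) ^ (a + b) * ((starRingEnd ℂ) ζ ^ a * ζ ^ b) ^ i := by
    intro j i
    change (starRingEnd ℂ) ((√((j : ℕ) / N : ℝ) : ℂ) * ζ ^ i) ^ a *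
      ((√((j : ℕ) / N : ℝ) : ℂ) * ζ ^ i) ^ b = _
    rw [map_mul, Complex.conj_ofReal, map_pow]
    ring
  simp only [discSum, hval, ← Finset.mul_sum (Finset.range N)]
  split_ifs with hab
  · subst hab
    rw [Complex.ofReal_sum, ← Fin.sum_univ_eq_sum_range
      (fun j : ℕ => ((bernsteinWeight m N j * ((j : ℝ) / N) ^ a : ℝ) : ℂ))]
    refine Finset.sum_congr rfl fun j _ => ?_
    rw [← mul_pow, hconj]
    have hsq : (√((j : ℕ) / N : ℝ) : ℂ) ^ (a + a) = (((j : ℕ) / N : ℝ) : ℂ) ^ a := by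
      rw [← two_mul, pow_mul, ← Complex.ofReal_pow, Real.sq_sqrt (by positivity)]
    rw [hsq]
    simp only [one_pow, Finset.sum_const, Finset.card_range, nsmul_eq_mul, mul_one]
    push_cast
    field_simp
  · have hc : (starRingEnd ℂ) ζ ^ a * ζ ^ b ≠ 1 := by
      intro h
      apply hab
      refine hprim.pow_inj ha hb ?_
      calc ζ ^ a = ζ ^ a * ((starRingEnd ℂ) ζ ^ a * ζ ^ b) := by rw [h, mul_one]
        _ = ((starRingEnd ℂ) ζ * ζ) ^ a * ζ ^ b := by ring
        _ = ζ ^ b := by rw [hconj, one_pow, one_mul]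
    have hcN : ((starRingEnd ℂ) ζ ^ a * ζ ^ b) ^ N = 1 := by
      rw [mul_pow, ← pow_mul, ← pow_mul, mul_comm a, mul_comm b, pow_mul, pow_mul, ← map_pow,
        hprim.pow_eq_one, map_one, one_pow, one_pow, one_mul]
    have hg : ∑ i ∈ Finset.range N, ((starRingEnd ℂ) ζ ^ a * ζ ^ b) ^ i = 0 := by
      rw [geom_sum_eq hc, hcN, sub_self, zero_div]
    simp [hg]

/-- Hausdorff's moment theorem in the form needed for weighted shifts: a completely monotone
sequence `m` gives a rotation-symmetric positive functional on the closed disc with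
`∫ ‖z‖ ^ (2 n) = m n`. -/
theorem CompletelyMonotone.exists_positiveLinearMap {m : ℕ → ℝ} (hm : CompletelyMonotone m) :
    ∃ Λ : C(ClosedDisc, ℂ) →ₚ[ℂ] ℂ,
      ∀ a b, Λ (star discCoord ^ a * discCoord ^ b) = if a = b then (m a : ℂ) else 0 := by
  -- The values `discSum m N f` stay in a compact disc, so a limit along one fixed ultrafilter
  -- exists for all `f` at once and is automatically linear and positive.
  let U : Ultrafilter ℕ := hyperfilter ℕ
  have hU : (U : Filter ℕ) ≤ atTop := Nat.hyperfilter_le_atTop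
  have hex : ∀ f, ∃ c, Tendsto (fun N => discSum m N f) U (𝓝 c) := by
    intro f
    obtain ⟨c, -, hc⟩ := isCompact_iff_ultrafilter_le_nhds.1
      (isCompact_closedBall (0 : ℂ) (m 0 * ‖f‖)) (U.map fun N => discSum m N f)
      (by
        rw [le_principal_iff]
        exact Eventually.of_forall (f := (U : Filter ℕ)) fun N =>
          mem_closedBall_zero_iff.2 (hm.norm_discSum_le N f))
    exact ⟨c, hc⟩
  choose Λ hΛ using hex
  let Λ' : C(ClosedDisc, ℂ) →ₗ[ℂ] ℂ :=
    { toFun := Λ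
      map_add' := fun f g => tendsto_nhds_unique (hΛ (f + g)) <| by
        simpa only [discSum_add] using (hΛ f).add (hΛ g)
      map_smul' := fun c f => tendsto_nhds_unique (hΛ (c • f)) <| by
        simpa only [discSum_smul, RingHom.id_apply, smul_eq_mul] using (hΛ f).const_mul c }
  refine ⟨PositiveLinearMap.mk₀ Λ' fun f hf =>
    ge_of_tendsto (hΛ f) (.of_forall fun N => hm.discSum_nonneg N hf), fun a b => ?_⟩
  refine tendsto_nhds_unique (hΛ (star discCoord ^ a * discCoord ^ b)) ?_
  have hev : ∀ᶠ N in (U : Filter ℕ), discSum m N (star discCoord ^ a * discCoord ^ b) =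
      if a = b then ((∑ j ∈ Finset.range (N + 1),
        bernsteinWeight m N j * ((j : ℝ) / N) ^ a : ℝ) : ℂ) else 0 := by
    filter_upwards [hU (eventually_gt_atTop a), hU (eventually_gt_atTop b)] with N h1 h2
    exact discSum_star_pow_mul_pow m h1 h2
  rw [tendsto_congr' hev]
  split_ifs
  · exact (Complex.continuous_ofReal.tendsto _).comp ((hm.tendsto_sum_bernsteinWeight a).mono_left hU)
  · exact tendsto_const_nhds

/-! ### Subnormality through the GNS construction. -/

/-- Berger's criterion: a weighted shift whose moments `∏ i < n, β_i ^ 2` are completely monotone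
is subnormal. -/
theorem isSubnormalShift_of_completelyMonotone {β : ℕ → ℝ} (hβ : ∀ n, 0 < β n)
    (hbdd : BddAbove (Set.range fun n => |β n|))
    (hm : CompletelyMonotone fun n => ∏ i ∈ Finset.range n, β i ^ 2) : IsSubnormalShift β := by
  obtain ⟨Λ, hΛ⟩ := hm.exists_positiveLinearMap
  refine ⟨hbdd, ?_⟩
  let P : ℕ → ℝ := fun n => ∏ i ∈ Finset.range n, β i
  have hP : ∀ n, 0 < P n := fun n => Finset.prod_pos fun i _ => hβ i
  have hP' : ∀ n, (P n : ℂ) ≠ 0 := fun n => by exact_mod_cast (hP n).ne'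
  -- The classes of `z ^ n` are orthogonal by rotation symmetry and have norm `P n`. Multiplication
  -- by `z` sends `v n` to `P (n + 1) / P n = β n` times `v (n + 1)`.
  let v : ℕ → Λ.GNS := fun n => ((Λ.toPreGNS ((P n : ℂ)⁻¹ • discCoord ^ n) : Λ.PreGNS) : Λ.GNS)
  have hv : Orthonormal ℂ v := by
    rw [orthonormal_iff_ite]
    intro a b
    rw [UniformSpace.Completion.inner_coe, PositiveLinearMap.preGNS_inner_def]
    simp only [PositiveLinearMap.ofPreGNS_toPreGNS, star_smul, star_pow, smul_mul_smul_comm,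
      map_smul, hΛ, smul_eq_mul]
    split_ifs with hab
    · subst hab
      have : ((∏ i ∈ Finset.range a, β i ^ 2 : ℝ) : ℂ) = (P a : ℂ) ^ 2 := by
        rw [Finset.prod_pow, Complex.ofReal_pow]
      rw [this]
      simp only [star_inv₀, Complex.star_def, Complex.conj_ofReal]
      field_simp [hP' a]
    · simp
  let V : EllTwo →ₗᵢ[ℂ] Λ.GNS := hv.orthogonalFamily.linearIsometry
  have hV : ∀ n (c : ℂ), V (lp.single 2 n c) = c • v n := fun n c => by
    change hv.orthogonalFamily.linearIsometry (lp.single 2 n c) = _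
    rw [OrthogonalFamily.linearIsometry_apply_single]
    simp
  let N : Λ.GNS →L[ℂ] Λ.GNS := Λ.gnsStarAlgHom discCoord
  have hN : ∀ n, N (v n) = (β n : ℂ) • v (n + 1) := by
    intro n
    change Λ.gnsNonUnitalStarAlgHom discCoord (v n) = _
    rw [PositiveLinearMap.gnsNonUnitalStarAlgHom_apply_coe,
      PositiveLinearMap.leftMulMapPreGNS_apply, ← UniformSpace.Completion.coe_smul, ← map_smul]
    congr 2
    have : P (n + 1) = P n * β n := Finset.prod_range_succ _ _
    have hβn : (β n : ℂ) ≠ 0 := by exact_mod_cast (hβ n).ne'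
    rw [PositiveLinearMap.ofPreGNS_toPreGNS, smul_smul, pow_succ', mul_smul_comm, this]
    congr 1
    push_cast
    field_simp
  refine ⟨Λ.GNS, inferInstance, inferInstance, inferInstance, N, V, ⟨?_⟩, fun x => ?_⟩
  -- Normality is inherited from the commutativity of `C(ClosedDisc, ℂ)`.
  · change star (Λ.gnsStarAlgHom discCoord) * Λ.gnsStarAlgHom discCoord =
      Λ.gnsStarAlgHom discCoord * star (Λ.gnsStarAlgHom discCoord)
    rw [← map_star, ← map_mul, ← map_mul, mul_comm]
  · have h : N ∘L V.toContinuousLinearMap = V.toContinuousLinearMap ∘L weightedShift β hbdd := by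
      refine lp.ext_continuousLinearMap (by norm_num) fun n => ?_
      ext
      change N (V (lp.single 2 n 1)) = V (weightedShift β hbdd (lp.single 2 n 1))
      rw [weightedShift_single, map_smul, hV, hV, one_smul, one_smul, hN]
    exact congrArg (fun T : EllTwo →L[ℂ] Λ.GNS => T x) h

/-! ### Contractivity, MID shifts and the corollary. -/

lemma norm_weightedShift_le_one_iff {α : ℕ → ℝ} (hα : BddAbove (Set.range fun n => |α n|)) :
    ‖weightedShift α hα‖ ≤ 1 ↔ ∀ n, |α n| ≤ 1 := by
  constructor
  · intro h n
    have h1 := (weightedShift α hα).le_of_opNorm_le h (lp.single 2 n (1 : ℂ))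
    rw [weightedShift_single, norm_smul, lp.norm_single (by norm_num),
      lp.norm_single (by norm_num)] at h1
    simpa using h1
  · intro h
    refine ContinuousLinearMap.opNorm_le_bound _ zero_le_one fun x => ?_
    refine le_of_sq_le_sq ?_ (by positivity)
    have hs := summable_shiftCoord h x
    rw [one_mul, norm_sq_eq_tsum, norm_sq_eq_tsum x]
    change (∑' i, ‖shiftCoord α x i‖ ^ 2) ≤ _
    have h0 : ‖shiftCoord α x 0‖ ^ 2 = 0 := by simp [shiftCoord]
    rw [hs.tsum_eq_zero_add, h0, zero_add]
    exact ((summable_nat_add_iff 1).2 hs).tsum_le_tsum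
      (fun n => by simpa only [one_pow, one_mul] using norm_shiftCoord_succ_sq_le h x n) (summable_norm_sq x)

lemma bddAbove_range_abs_of_le_one {α : ℕ → ℝ} (h0 : ∀ n, 0 < α n) (h1 : ∀ n, α n ≤ 1) :
    BddAbove (Set.range fun n => |α n|) :=
  ⟨1, by rintro _ ⟨n, rfl⟩; exact (abs_of_pos (h0 n)).trans_le (h1 n)⟩

lemma isContractiveShift_iff {α : ℕ → ℝ} (h0 : ∀ n, 0 < α n) :
    IsContractiveShift α ↔ ∀ n, α n ≤ 1 := by
  constructor
  · rintro ⟨hα, h⟩ n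
    exact (le_abs_self _).trans ((norm_weightedShift_le_one_iff hα).1 h n)
  · intro h1
    refine ⟨bddAbove_range_abs_of_le_one h0 h1, ?_⟩
    rw [norm_weightedShift_le_one_iff]
    exact fun n => (abs_of_pos (h0 n)).trans_le (h1 n)

/-- A contractive weighted shift with log completely alternating weights is moment infinitely
divisible. -/
theorem LogCompletelyAlternating.isMIDShift {α : ℕ → ℝ} (h : LogCompletelyAlternating α)
    (h1 : ∀ n, α n ≤ 1) : IsMIDShift α := by
  refine ⟨h.1, fun t ht => ?_⟩
  have hp : ∀ n, 0 < α n ^ t := fun n => Real.rpow_pos_of_pos (h.1 n) t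
  refine isSubnormalShift_of_completelyMonotone hp (bddAbove_range_abs_of_le_one hp fun n =>
    Real.rpow_le_one (h.1 n).le (h1 n) ht.le) ?_
  -- The factor is `2 * t` because moments are products of squared weights `(α i ^ t) ^ 2`.
  have hφ := ((h.2.neg_sum_range fun n => Real.log_nonpos (h.1 n).le (h1 n)).const_mul
    (mul_nonneg zero_le_two ht.le)).exp_neg
  convert hφ using 2 with n
  rw [mul_neg, neg_neg, Finset.mul_sum, Real.exp_sum]
  refine Finset.prod_congr rfl fun i _ => ?_
  rw [Real.rpow_def_of_pos (h.1 i), ← Real.exp_nat_mul]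
  push_cast
  ring_nf

lemma IsMIDShift.isSubnormalShift {α : ℕ → ℝ} (h : IsMIDShift α) : IsSubnormalShift α := by
  simpa using h.2 1 one_pos

lemma CompletelyAlternating.logCompletelyAlternating {α : ℕ → ℝ} (h : CompletelyAlternating α)
    (h0 : ∀ n, 0 < α n) (h1 : ∀ n, α n ≤ 1) : LogCompletelyAlternating α :=
  ⟨h0, h.log h0 h1⟩

lemma cesaro_pos {x : ℕ → ℝ} (h : ∀ n, 0 < x n) (n : ℕ) : 0 < cesaro x n :=
  div_pos (Finset.sum_pos (fun i _ => h i) (by simp)) (by positivity)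

lemma cesaro_le {x : ℕ → ℝ} {c : ℝ} (h : ∀ n, x n ≤ c) (n : ℕ) : cesaro x n ≤ c := by
  rw [cesaro, div_le_iff₀ (by positivity)]
  refine (Finset.sum_le_sum fun i _ => h i).trans_eq ?_
  simp [mul_comm]

lemma geomCesaro_pos {x : ℕ → ℝ} (h : ∀ n, 0 < x n) (n : ℕ) : 0 < geomCesaro x n :=
  Real.rpow_pos_of_pos (Finset.prod_pos fun i _ => h i) _

lemma log_geomCesaro {x : ℕ → ℝ} (h : ∀ n, 0 < x n) (n : ℕ) :
    Real.log (geomCesaro x n) = cesaro (fun i => Real.log (x i)) n := by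
  rw [geomCesaro, Real.log_rpow (Finset.prod_pos fun i _ => h i),
    Real.log_prod fun i _ => (h i).ne', cesaro, one_div_mul_eq_div]

lemma LogCompletelyAlternating.geomCesaro {x : ℕ → ℝ} (h : LogCompletelyAlternating x) :
    LogCompletelyAlternating (geomCesaro x) :=
  ⟨geomCesaro_pos h.1, by simpa only [log_geomCesaro h.1] using h.2.cesaro⟩

lemma geomCesaro_le_one {x : ℕ → ℝ} (h0 : ∀ n, 0 < x n) (h1 : ∀ n, x n ≤ 1) (n : ℕ) :
    geomCesaro x n ≤ 1 :=
  Real.rpow_le_one (Finset.prod_nonneg fun i _ => (h0 i).le)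
    (Finset.prod_le_one (fun i _ => (h0 i).le) fun i _ => h1 i) (by positivity)

lemma logCompletelyAlternating_sq_iff {x : ℕ → ℝ} (h0 : ∀ n, 0 < x n) :
    LogCompletelyAlternating (fun n => x n ^ 2) ↔ LogCompletelyAlternating x := by
  have e : (fun n => Real.log (x n ^ 2)) = fun n => 2 * Real.log (x n) := by
    ext n; rw [Real.log_pow]; norm_num
  constructor
  · intro h
    refine ⟨h0, ?_⟩
    have h2 := h.2
    rw [e] at h2
    simpa using h2.const_mul (c := 2⁻¹) (by norm_num)
  · intro h
    refine ⟨fun n => pow_pos (h0 n) 2, ?_⟩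
    rw [e]
    exact h.2.const_mul zero_le_two

/-- A completely alternating weight sequence in `(0, 1]` gives a contractive, moment infinitely
divisible, subnormal shift. -/
theorem CompletelyAlternating.isContractiveShift_and_isMIDShift_and_isSubnormalShift
    {α : ℕ → ℝ} (h : CompletelyAlternating α) (h0 : ∀ n, 0 < α n) (h1 : ∀ n, α n ≤ 1) :
    CompletelyAlternating α ∧ IsContractiveShift α ∧ IsMIDShift α ∧ IsSubnormalShift α :=
  have hM := (h.logCompletelyAlternating h0 h1).isMIDShift h1
  ⟨h, (isContractiveShift_iff h0).2 h1, hM, hM.isSubnormalShift⟩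

theorem corollary3p10 (α : ℕ → ℝ) (hpos : ∀ n, 0 < α n) (hcontr : IsContractiveShift α) :
    (CompletelyAlternating (fun n => α n ^ 2) →
      (CompletelyAlternating (fun n => √(cesaro (fun m => α m ^ 2) n)) ∧
        IsContractiveShift (fun n => √(cesaro (fun m => α m ^ 2) n)) ∧
        IsMIDShift (fun n => √(cesaro (fun m => α m ^ 2) n)) ∧
        IsSubnormalShift (fun n => √(cesaro (fun m => α m ^ 2) n))) ∧
      (CompletelyAlternating (cesaro α) ∧
        IsContractiveShift (cesaro α) ∧
        IsMIDShift (cesaro α) ∧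
        IsSubnormalShift (cesaro α))) ∧
    (LogCompletelyAlternating (fun n => α n ^ 2) ↔ LogCompletelyAlternating α) ∧
    (LogCompletelyAlternating (fun n => α n ^ 2) →
      LogCompletelyAlternating (geomCesaro α) ∧
        IsMIDShift (geomCesaro α) ∧
        IsSubnormalShift (geomCesaro α)) := by
  have h1 := (isContractiveShift_iff hpos).1 hcontr
  have hsq0 : ∀ n, 0 < α n ^ 2 := fun n => pow_pos (hpos n) 2
  have hsq1 : ∀ n, α n ^ 2 ≤ 1 := fun n => pow_le_one₀ (hpos n).le (h1 n)
  refine ⟨fun h => ⟨?_, ?_⟩, logCompletelyAlternating_sq_iff hpos, fun h => ?_⟩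
  · exact (h.cesaro.sqrt (cesaro_pos hsq0)
      (cesaro_le hsq1)).isContractiveShift_and_isMIDShift_and_isSubnormalShift
      (fun n => Real.sqrt_pos.2 (cesaro_pos hsq0 n))
      fun n => Real.sqrt_le_one.2 (cesaro_le hsq1 n)
  -- Here the root is taken before averaging: `α = √(α ^ 2)`.
  · have hα : CompletelyAlternating α := by
      simpa only [Real.sqrt_sq (hpos _).le] using h.sqrt hsq0 hsq1
    exact hα.cesaro.isContractiveShift_and_isMIDShift_and_isSubnormalShift
      (cesaro_pos hpos) (cesaro_le h1)
  · have hG := ((logCompletelyAlternating_sq_iff hpos).1 h).geomCesaro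
    have hM := hG.isMIDShift (geomCesaro_le_one hpos h1)
    exact ⟨hG, hM, hM.isSubnormalShift⟩
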